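/- Let $X$ be a smooth 4-manifold (Hausdorff, second countable, without boundary), none of whose connected components is compact, and let $\omega$ be a symplectic form on $X$. Then the following are equivalent: 1. there is a smooth almost complex structure $J$ on $X$ such that $\omega$ is $J$-anti-invariant, that is, $\omega(Ju,Jv)=-\omega(u,v)$ for all $x\in X$ and $u,v\in T_xX$, so that the class $[\omega]$ lies in $H^-_J(X)$, the set of classes in $H^2(X;\mathbb{R})$ represented by smooth closed $J$-anti-invariant 2-forms; 2. $TX$ is symplectically trivial, that is, there are smooth vector fields $V_1,V_2,W_1,W_2$ on $X$ with $\omega(V_i,W_j)=\delta_{ij}$ and $\omega(V_i,V_j)=\omega(W_i,W_j)=0$ for $i,j\in\{1,2\}$. -/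

import Mathlib

open scoped Manifold ContDiff

noncomputable section

namespace AntiInvariant

/-- A (not necessarily smooth) real differential `k`-form on an `n`-dimensional manifold `X`. -/
abbrev Form (n k : ℕ) (X : Type*) [TopologicalSpace X]
    [ChartedSpace (EuclideanSpace ℝ (Fin n)) X] : Type _ :=
  (x : X) → TangentSpace (𝓡 n) x [⋀^Fin k]→L[ℝ] ℝ

section

variable {n k : ℕ} {X : Type*} [TopologicalSpace X] [ChartedSpace (EuclideanSpace ℝ (Fin n)) X]

/-- The expression of a form in the preferred chart around `x₀`, that is, its pullback along the
inverse of that chart. Only its values on the target of the chart are meaningful. -/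
def Form.inChart (α : Form n k X) (x₀ : X) (u : EuclideanSpace ℝ (Fin n)) :
    EuclideanSpace ℝ (Fin n) [⋀^Fin k]→L[ℝ] ℝ :=
  (α ((extChartAt (𝓡 n) x₀).symm u)).compContinuousLinearMap
    (mfderiv (𝓡 n) (𝓡 n) (extChartAt (𝓡 n) x₀).symm u)

/-- The form is smooth in every preferred chart. -/
def Form.IsSmooth (α : Form n k X) : Prop :=
  ∀ x₀ : X, ContDiffOn ℝ ∞ (α.inChart x₀) (extChartAt (𝓡 n) x₀).target

/-- `dα = 0`, where `d` is computed in the preferred charts. -/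
def Form.IsClosed (α : Form n k X) : Prop :=
  ∀ x₀ : X, ∀ u ∈ (extChartAt (𝓡 n) x₀).target, extDeriv (α.inChart x₀) u = 0

/-- `γ = dβ`, where `d` is computed in the preferred charts. -/
def Form.IsExteriorDerivative (γ : Form n (k + 1) X) (β : Form n k X) : Prop :=
  ∀ x₀ : X, ∀ u ∈ (extChartAt (𝓡 n) x₀).target, γ.inChart x₀ u = extDeriv (β.inChart x₀) u

/-- `α` and `γ` differ by the differential of a smooth form. For smooth closed forms: they define
the same de Rham cohomology class. -/
def Form.Cohomologous (α γ : Form n (k + 1) X) : Prop :=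
  ∃ β : Form n k X, β.IsSmooth ∧ (α - γ).IsExteriorDerivative β

/-- A symplectic form: a smooth closed 2-form that is nondegenerate at every point. -/
structure IsSymplectic (Ω : Form n 2 X) : Prop where
  smooth : Ω.IsSmooth
  closed : Ω.IsClosed
  nondegenerate : ∀ (x : X) (v : TangentSpace (𝓡 n) x),
    (∀ w : TangentSpace (𝓡 n) x, Ω x ![v, w] = 0) → v = 0

/-- A smooth vector field, as a smooth section of the tangent bundle. -/
def IsSmoothVectorField (V : (x : X) → TangentSpace (𝓡 n) x) [IsManifold (𝓡 n) ∞ X] : Prop :=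
  ContMDiff (𝓡 n) (𝓡 n).tangent ∞ (fun x => (⟨x, V x⟩ : TangentBundle (𝓡 n) X))

end

/-- A smooth almost complex structure: a smooth section `J` of the endomorphism bundle of the
tangent bundle with `J ∘ J = -id`. -/
structure AlmostComplexStructure (n : ℕ) (X : Type*) [TopologicalSpace X]
    [ChartedSpace (EuclideanSpace ℝ (Fin n)) X] [IsManifold (𝓡 n) ∞ X] where
  toFun : (x : X) → TangentSpace (𝓡 n) x →L[ℝ] TangentSpace (𝓡 n) x
  smooth : ContMDiff (𝓡 n)
    ((𝓡 n).prod 𝓘(ℝ, EuclideanSpace ℝ (Fin n) →L[ℝ] EuclideanSpace ℝ (Fin n))) ∞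
    (fun x => Bundle.TotalSpace.mk' (EuclideanSpace ℝ (Fin n) →L[ℝ] EuclideanSpace ℝ (Fin n))
      (E := fun x : X => TangentSpace (𝓡 n) x →L[ℝ] TangentSpace (𝓡 n) x) x (toFun x))
  sq_eq_neg : ∀ (x : X) (v : TangentSpace (𝓡 n) x), toFun x (toFun x v) = -v

section

variable {n : ℕ} {X : Type*} [TopologicalSpace X] [ChartedSpace (EuclideanSpace ℝ (Fin n)) X]
  [IsManifold (𝓡 n) ∞ X]

/-- `J α = -α` for the action `(J α)(v, w) = α (J v, J w)`; that is, `α` is a real 2-form of type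
`(2,0) + (0,2)`. -/
def AlmostComplexStructure.IsAntiInvariant (J : AlmostComplexStructure n X) (α : Form n 2 X) :
    Prop :=
  ∀ (x : X) (v w : TangentSpace (𝓡 n) x), α x ![J.toFun x v, J.toFun x w] = -α x ![v, w]

/-- For a smooth closed 2-form `α`: its class lies in the anti-invariant cohomology `H⁻_J(X)`,
that is, some smooth closed `J`-anti-invariant 2-form represents the de Rham class of `α`. -/
def AlmostComplexStructure.ClassMemAntiInvariantCohomology (J : AlmostComplexStructure n X)
    (α : Form n 2 X) : Prop :=
  ∃ γ : Form n 2 X, γ.IsSmooth ∧ γ.IsClosed ∧ J.IsAntiInvariant γ ∧ α.Cohomologous γ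

end

/-- The tangent bundle of a 4-manifold is symplectically trivial with respect to `Ω`: there is a
global smooth symplectic frame `V₁, V₂, W₁, W₂`. (The relations imply that it is a basis of every
tangent space if `X` has dimension 4.) -/
def IsSymplecticallyTrivial {X : Type*} [TopologicalSpace X]
    [ChartedSpace (EuclideanSpace ℝ (Fin 4)) X] [IsManifold (𝓡 4) ∞ X] (Ω : Form 4 2 X) : Prop :=
  ∃ V W : Fin 2 → (x : X) → TangentSpace (𝓡 4) x,
    (∀ i, IsSmoothVectorField (V i)) ∧ (∀ i, IsSmoothVectorField (W i)) ∧
    ∀ (x : X) (i j : Fin 2),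
      Ω x ![V i x, W j x] = (if i = j then 1 else 0) ∧
      Ω x ![V i x, V j x] = 0 ∧ Ω x ![W i x, W j x] = 0

end AntiInvariant

end

/-!
If `Ω` is anti-invariant under `J`, then `Ω(·, ·) - i Ω(J ·, ·)` is a nondegenerate complex bilinear
alternating form, a complex area form on the complex plane bundle `(TX, J)`. Two complex
independent vector fields `V`, `W` of area one give the symplectic frame `V, J V, W, -J W`. Once `V`
vanishes nowhere, the fields `W` of area one with `V` form an affine condition that has local
solutions, and a partition of unity produces a global one. Conversely, a symplectic frame
`V₁, V₂, W₁, W₂` defines `J` by `V₁ ↦ V₂`, `W₂ ↦ W₁`, and `Ω` is anti-invariant under it.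

What remains is a nowhere vanishing vector field on a manifold without compact components
(`exists_isContinuousSection_ne_zero`, for any vector bundle whose rank is the dimension of the
base; `exists_smooth_vectorField_ne_zero` then makes it smooth). Working with continuous sections,
three tools carry the proof:

* in a chart the zeros can be made isolated, by a smooth approximation and a regular value of it,
  which exists by the equidimensional case of Sard's theorem
  (`exists_perturbation_finite_zeros`); chart by chart, this gives a section with locally finite
  zeros (`exists_isContinuousSection_hasLocallyFiniteZeros`);
* if the boundary of a chart ball contains no zeros, coning off replaces the zeros in the ball by
  one zero at an arbitrary interior point (`exists_cone_extension`), so that a zero can be moved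
  along any connected open set (`canMoveZero_of_isPreconnected`);
* every compact set lies in one whose complement has no relatively compact components
  (`exists_isFilledCompact_superset`), and from the complement of the latter zeros can be moved
  out of any compact set.

Along an exhaustion by such compact sets the zeros are pushed to infinity, and the sections
stabilize on each of the sets.
-/

open scoped Manifold ContDiff

namespace AntiInvariant

open Set Filter Topology Bundle Metric MeasureTheory

/-! ### Maps of Euclidean space: cones and regular values -/

section Euclidean

variable {E : Type*} [NormedAddCommGroup E] [NormedSpace ℝ E] [FiniteDimensional ℝ E]

/-- The cone from `a` over the values of `f` on the sphere of radius `R` around `a`: it replaces all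
zeros of `f` in the ball by a single zero, at a centre that can be prescribed. -/
theorem exists_cone_extension {U : Set E} {f : E → E} (hf : ContinuousOn f U) {a : E} {R : ℝ}
    (hR : 0 < R) (hU : closedBall a R ⊆ U) (h0 : ∀ u ∈ sphere a R, f u ≠ 0) :
    ∃ g : E → E, ContinuousOn g U ∧ (∀ u ∉ closedBall a R, g u = f u) ∧
      ∀ u ∈ closedBall a R, g u = 0 → u = a := by
  classical
  -- the radial projection to the sphere, away from the centre
  let p : E → E := fun u => a + (R / ‖u - a‖) • (u - a)
  have hp : ∀ u, u ≠ a → p u ∈ sphere a R := by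
    intro u hu
    have : ‖u - a‖ ≠ 0 := norm_ne_zero_iff.2 (sub_ne_zero.2 hu)
    simp [p, norm_smul, abs_of_pos hR, this]
  let c : E → E := fun u => (‖u - a‖ / R) • f (p u)
  have hsph : ∀ u ∈ sphere a R, c u = f u := by
    intro u hu
    have hu' : ‖u - a‖ = R := by simpa [dist_eq_norm] using hu
    simp [c, p, hu', hR.ne']
  have hcont : ContinuousOn c (closedBall a R) := by
    intro u hu
    by_cases hua : u = a
    · subst hua
      have : ProperSpace E := FiniteDimensional.proper ℝ E
      obtain ⟨C, hC⟩ := (isCompact_sphere u R).exists_bound_of_continuousOn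
        (hf.mono (sphere_subset_closedBall.trans hU))
      have hcu : c u = 0 := by simp [c]
      apply ContinuousAt.continuousWithinAt
      rw [ContinuousAt, hcu]
      have hlim : Tendsto (fun v => ‖v - u‖ / R * C) (𝓝 u) (𝓝 0) := by
        have : Continuous fun v : E => ‖v - u‖ / R * C := by fun_prop
        simpa using this.tendsto u
      refine squeeze_zero_norm (fun v => ?_) hlim
      by_cases hv : v = u
      · simp [hv, c]
      · rw [norm_smul, Real.norm_of_nonneg (by positivity)]
        gcongr
        exact hC _ (hp v hv)
    · have h1 : ‖u - a‖ ≠ 0 := norm_ne_zero_iff.2 (sub_ne_zero.2 hua)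
      have h2 : ContinuousAt p u := by
        refine continuousAt_const.add (ContinuousAt.smul
          (ContinuousAt.div continuousAt_const ?_ h1) ?_) <;> fun_prop
      have h3 : ContinuousWithinAt (fun v => f (p v)) (closedBall a R ∩ {v | v ≠ a}) u := by
        have := hf (p u) (hU (sphere_subset_closedBall (hp u hua)))
        exact this.comp h2.continuousWithinAt
          fun v hv => hU (sphere_subset_closedBall (hp v hv.2))
      have h4 : ContinuousWithinAt (fun v => f (p v)) (closedBall a R) u :=
        h3.mono_of_mem_nhdsWithin
          (inter_mem self_mem_nhdsWithin (mem_nhdsWithin_of_mem_nhds (isOpen_ne.mem_nhds hua)))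
      refine ContinuousWithinAt.smul ?_ h4
      fun_prop
  refine ⟨fun u => if u ∈ closedBall a R then c u else f u, ?_,
    fun u hu => by simp only [if_neg hu], fun u hu h => ?_⟩
  · have h1 : ContinuousOn (fun u => if u ∈ closedBall a R then c u else f u) (closedBall a R) :=
      hcont.congr fun u hu => by simp only [if_pos hu]
    have h2 : ContinuousOn (fun u => if u ∈ closedBall a R then c u else f u)
        (U ∩ (ball a R)ᶜ) := by
      refine (hf.mono inter_subset_left).congr fun u hu => ?_
      by_cases hu' : u ∈ closedBall a R
      · simp only [if_pos hu']
        refine hsph u (le_antisymm hu' (not_lt.1 hu.2))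
      · simp only [if_neg hu']
    intro u hu
    have h3 : U ⊆ closedBall a R ∪ (U ∩ (ball a R)ᶜ) := fun v hv => by
      by_cases h : v ∈ ball a R
      · exact Or.inl (ball_subset_closedBall h)
      · exact Or.inr ⟨hv, h⟩
    refine ContinuousWithinAt.mono (ContinuousWithinAt.union ?_ ?_) h3
    · by_cases h : u ∈ closedBall a R
      · exact h1 u h
      · exact continuousWithinAt_of_notMem_closure (by rwa [isClosed_closedBall.closure_eq])
    · by_cases h : u ∈ ball a R
      · refine continuousWithinAt_of_notMem_closure fun h' => ?_
        have := closure_mono (inter_subset_right (s := U)) h'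
        rw [isOpen_ball.isClosed_compl.closure_eq] at this
        exact this h
      · exact h2 u ⟨hu, h⟩
  · by_contra hua
    simp only [if_pos hu, c, smul_eq_zero] at h
    rcases h with h | h
    · rw [div_eq_zero_iff] at h
      exact h.elim (fun h => hua (sub_eq_zero.1 (norm_eq_zero.1 h))) hR.ne'
    · exact h0 _ (hp u hua) h

/-- A smooth map has arbitrarily small regular values, by the equidimensional case of Sard's
theorem, and the preimage of a regular value is discrete. -/
theorem exists_small_finite_preimage {h : E → E} (hh : ContDiff ℝ ∞ h) {ε : ℝ} (hε : 0 < ε) :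
    ∃ c : E, ‖c‖ < ε ∧ ∀ K : Set E, IsCompact K → {u ∈ K | h u = c}.Finite := by
  let _ : MeasurableSpace E := borel E
  have : BorelSpace E := ⟨rfl⟩
  let μ : Measure E := Measure.addHaar
  have hd : Differentiable ℝ h := hh.differentiable (by simp)
  have hnull : μ (h '' {u | (fderiv ℝ h u).det = 0}) = 0 :=
    addHaar_image_eq_zero_of_det_fderivWithin_eq_zero μ
      (fun x _ => (hd x).hasFDerivAt.hasFDerivWithinAt) (fun x hx => hx)
  obtain ⟨c, hc, hcn⟩ : ∃ c ∈ ball (0 : E) ε, c ∉ h '' {u | (fderiv ℝ h u).det = 0} := by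
    by_contra hcon
    push Not at hcon
    have := measure_mono_null (fun c hc => hcon c hc) hnull
    exact (measure_ball_pos μ (0 : E) hε).ne' this
  refine ⟨c, by simpa using hc, fun K hK => ?_⟩
  by_contra hinf
  obtain ⟨u, -, hu⟩ := Set.Infinite.exists_accPt_of_subset_isCompact hinf hK (sep_subset _ _)
  have hcl : IsClosed {u | h u = c} := isClosed_eq hh.continuous continuous_const
  have huc : h u = c := by
    have h1 : u ∈ closure {u ∈ K | h u = c} := mem_closure_iff_clusterPt.2 hu.clusterPt
    exact (closure_minimal (fun v hv => hv.2) hcl) h1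
  have hdet : (fderiv ℝ h u).det ≠ 0 := fun h' => hcn ⟨u, h', huc⟩
  have hanti : ∃ C, AntilipschitzWith C (fderiv ℝ h u) :=
    ⟨_, ((fderiv ℝ h u).toContinuousLinearEquivOfDetNeZero hdet).antilipschitz⟩
  have hne := (hd u).hasFDerivAt.eventually_ne (c := c) hanti
  rw [accPt_iff_frequently_nhdsNE] at hu
  exact hu (hne.mono fun v hv h' => hv h'.2)

/-- The zeros of `f` in the compact set `K` can be made finite in number by a modification
supported in any open set `N` in whose complement they are already finite. -/
theorem exists_perturbation_finite_zeros {U N K : Set E} {f : E → E} (hU : IsOpen U)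
    (hf : ContinuousOn f U) (hN : IsOpen N) (hNU : N ⊆ U) (hK : IsCompact K) (hKU : K ⊆ U)
    (hfin : {u ∈ K | f u = 0 ∧ u ∉ N}.Finite) (hcomp : IsCompact {u ∈ K | f u = 0 ∧ u ∈ N}) :
    ∃ g : E → E, ContinuousOn g U ∧ (∃ L, IsCompact L ∧ L ⊆ N ∧ ∀ u ∉ L, g u = f u) ∧
      {u ∈ K | g u = 0}.Finite := by
  have : ProperSpace E := FiniteDimensional.proper ℝ E
  obtain ⟨Z, hZ, hZ0, hZN⟩ := exists_compact_between hcomp hN fun u hu => hu.2.2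
  obtain ⟨χ, hχ1, hχc, hχN, hχ⟩ := exists_continuousMap_one_of_isCompact_subset_isOpen hZ hN hZN
  obtain ⟨ψ, hψ1, hψc, hψU, hψ⟩ :=
    exists_continuousMap_one_of_isCompact_subset_isOpen hχc hN hχN
  set L := tsupport χ with hL
  -- a globally defined continuous function that agrees with `f` on `L`
  have hF : Continuous fun u => ψ u • f u := by
    rw [continuous_iff_continuousAt]
    intro u
    by_cases hu : u ∈ tsupport ψ
    · exact ψ.continuous.continuousAt.smul (hf.continuousAt (hU.mem_nhds (hNU (hψU hu))))
    · have : (fun u => ψ u • f u) =ᶠ[𝓝 u] fun _ => 0 := by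
        filter_upwards [(isClosed_tsupport ψ).isOpen_compl.mem_nhds hu] with v hv
        rw [image_eq_zero_of_notMem_tsupport hv, zero_smul]
      exact continuousAt_const.congr this.symm
  -- `f` is bounded below on the part of `K ∩ L` where the cutoff is not `1`
  obtain ⟨δ, hδ, hδf⟩ : ∃ δ > 0, ∀ u ∈ (K ∩ L) \ interior Z, δ ≤ ‖f u‖ := by
    have hc : IsCompact ((K ∩ L) \ interior Z) :=
      (hK.inter_right (isClosed_tsupport _)).diff isOpen_interior
    have hne : ∀ u ∈ (K ∩ L) \ interior Z, f u ≠ 0 := fun u hu h0 =>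
      hu.2 (hZ0 ⟨hu.1.1, h0, hχN hu.1.2⟩)
    rcases ((K ∩ L) \ interior Z).eq_empty_or_nonempty with he | he
    · exact ⟨1, one_pos, by simp [he]⟩
    · obtain ⟨v, hv, hmin⟩ := hc.exists_isMinOn he
        (hf.norm.mono fun u hu => hKU hu.1.1)
      exact ⟨‖f v‖, norm_pos_iff.2 (hne v hv), fun u hu => hmin hu⟩
  obtain ⟨h, hh, hhF, -⟩ := hF.exists_contDiff_approx ⊤ (ε := fun _ => δ / 2) continuous_const
    (fun _ => half_pos hδ)
  obtain ⟨c, hc, hcfin⟩ := exists_small_finite_preimage hh (half_pos hδ)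
  have happ : ∀ u ∈ L, ‖h u - c - f u‖ < δ := by
    intro u hu
    have h1 := hhF u
    rw [hψ1 hu, Pi.one_apply, one_smul, dist_eq_norm] at h1
    calc ‖h u - c - f u‖ = ‖(h u - f u) - c‖ := by congr 1; abel
      _ ≤ ‖h u - f u‖ + ‖c‖ := norm_sub_le _ _
      _ < δ := by linarith
  have hoff : ∀ u ∉ L, f u + χ u • (h u - c - f u) = f u := fun u hu => by
    rw [image_eq_zero_of_notMem_tsupport hu, zero_smul, add_zero]
  refine ⟨fun u => f u + χ u • (h u - c - f u), ?_, ⟨L, hχc, hχN, hoff⟩, ?_⟩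
  · have := hh.continuous
    fun_prop
  · refine (hfin.union (hcfin Z hZ)).subset ?_
    rintro u ⟨huK, hu⟩
    by_cases huL : u ∈ L
    · by_cases huZ : u ∈ interior Z
      · right
        refine ⟨interior_subset huZ, ?_⟩
        simp only [hχ1 (interior_subset huZ), Pi.one_apply, one_smul] at hu
        rw [← sub_eq_zero, ← hu]; abel
      · exfalso
        have h1 := hδf u ⟨⟨huK, huL⟩, huZ⟩
        have h2 : ‖f u‖ = ‖χ u • (h u - c - f u)‖ := by
          exact (congrArg norm (eq_neg_of_add_eq_zero_left hu)).trans (norm_neg _)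
        rw [norm_smul, Real.norm_of_nonneg (hχ u).1] at h2
        have h3 : χ u * ‖h u - c - f u‖ ≤ ‖h u - c - f u‖ :=
          mul_le_of_le_one_left (norm_nonneg _) (hχ u).2
        linarith [happ u huL]
    · left
      simp only [hoff u huL] at hu
      refine ⟨huK, hu, fun huN => huL ?_⟩
      exact subset_tsupport _ (by
        simp [hχ1 (interior_subset (hZ0 ⟨huK, hu, huN⟩))])

end Euclidean

/-! ### Continuous sections and their modification inside a chart -/

section Sections

variable {E : Type*} {X : Type*} [TopologicalSpace X] {V : X → Type*}
  [TopologicalSpace (TotalSpace E V)]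

variable (E) in
/-- Continuity of a section of a vector bundle with model fibre `E`. -/
def IsContinuousSection (s : (x : X) → V x) : Prop :=
  Continuous fun x => (⟨x, s x⟩ : TotalSpace E V)

/-- The limit of a sequence of continuous sections that is eventually constant on the interior of
each member of an exhausting sequence of sets. -/
theorem exists_isContinuousSection_of_stabilizing {S : ℕ → (x : X) → V x}
    (hS : ∀ i, IsContinuousSection E (S i)) {A : ℕ → Set X} (hA : Monotone A)
    (hcover : ∀ x, ∃ i, x ∈ interior (A i)) (hstep : ∀ i, ∀ x ∈ A i, S (i + 1) x = S i x) :
    ∃ s : (x : X) → V x, IsContinuousSection E s ∧ ∀ i, ∀ x ∈ A i, s x = S i x := by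
  choose k hk using hcover
  have hle : ∀ i j, i ≤ j → ∀ x ∈ A i, S j x = S i x := by
    intro i j hij x hx
    induction j, hij using Nat.le_induction with
    | base => rfl
    | succ j hij ih => rw [hstep j x (hA hij hx), ih]
  have heq : ∀ i, ∀ x ∈ A i, S (k x) x = S i x := by
    intro i x hx
    rcases le_total i (k x) with h | h
    · exact hle _ _ h x hx
    · exact (hle _ _ h x (interior_subset (hk x))).symm
  refine ⟨fun x => S (k x) x, ?_, heq⟩
  rw [IsContinuousSection, continuous_iff_continuousAt]
  intro x
  refine (hS (k x)).continuousAt.congr ?_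
  filter_upwards [isOpen_interior.mem_nhds (hk x)] with y hy
  rw [heq (k x) y (interior_subset hy)]

variable [NormedAddCommGroup E]

theorem IsContinuousSection.continuousOn_coord {s : (x : X) → V x} (hs : IsContinuousSection E s)
    {φ : OpenPartialHomeomorph X E} {e : Trivialization E (π E V)} (hφ : φ.source ⊆ e.baseSet) :
    ContinuousOn (fun u => (e ⟨φ.symm u, s (φ.symm u)⟩).2) φ.target := by
  have h1 : ContinuousOn (fun x => (e ⟨x, s x⟩).2) φ.source :=
    continuous_snd.comp_continuousOn (e.continuousOn.comp hs.continuousOn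
      fun x hx => (e.mem_source).2 (hφ hx))
  exact h1.comp φ.continuousOn_symm φ.mapsTo_symm

variable [∀ x, AddCommGroup (V x)]

/-- A continuous section can be replaced inside a trivialized chart by any map to the model fibre
that agrees with its coordinate expression off a compact set. -/
theorem IsContinuousSection.exists_replace [T2Space X] {s : (x : X) → V x}
    (hs : IsContinuousSection E s) {φ : OpenPartialHomeomorph X E} {e : Trivialization E (π E V)}
    (hφ : φ.source ⊆ e.baseSet) {g : E → E} (hg : ContinuousOn g φ.target) {K : Set E}
    (hK : IsCompact K) (hKt : K ⊆ φ.target)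
    (h : ∀ u ∈ φ.target, u ∉ K → g u = (e ⟨φ.symm u, s (φ.symm u)⟩).2) :
    ∃ s' : (x : X) → V x, IsContinuousSection E s' ∧ (∀ x ∉ φ.symm '' K, s' x = s x) ∧
      ∀ x ∈ φ.source, (e ⟨x, s' x⟩).2 = g (φ x) := by
  classical
  let s' : (x : X) → V x := fun x => if x ∈ φ.source then e.symm x (g (φ x)) else s x
  have hoff : ∀ x ∉ φ.symm '' K, s' x = s x := by
    intro x hx
    by_cases hxs : x ∈ φ.source
    · have : φ x ∉ K := fun h' => hx ⟨φ x, h', φ.left_inv hxs⟩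
      simp only [s', if_pos hxs]
      rw [h (φ x) (φ.map_source hxs) this, φ.left_inv hxs, e.symm_apply_apply_mk (hφ hxs)]
    · simp only [s', if_neg hxs]
  refine ⟨s', ?_, hoff, fun x hx => ?_⟩
  · rw [IsContinuousSection, continuous_iff_continuousAt]
    intro x
    by_cases hxs : x ∈ φ.source
    · have h1 : ContinuousOn (fun x => e.toOpenPartialHomeomorph.symm (x, g (φ x))) φ.source := by
        refine e.toOpenPartialHomeomorph.continuousOn_symm.comp (continuousOn_id.prodMk
          (hg.comp φ.continuousOn φ.mapsTo)) fun x hx => ?_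
        exact e.mem_target.2 (hφ hx)
      refine (h1.continuousAt (φ.open_source.mem_nhds hxs)).congr ?_
      filter_upwards [φ.open_source.mem_nhds hxs] with y hy
      simp only [s', if_pos hy]
      exact (e.mk_symm (hφ hy) _).symm
    · have hcl : IsClosed (φ.symm '' K) := (hK.image_of_continuousOn
        (φ.continuousOn_symm.mono hKt)).isClosed
      have hx : x ∉ φ.symm '' K := by
        rintro ⟨u, hu, rfl⟩
        exact hxs (φ.map_target (hKt hu))
      refine hs.continuousAt.congr ?_
      filter_upwards [hcl.isOpen_compl.mem_nhds hx] with y hy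
      rw [hoff y hy]
  · simp only [s', if_pos hx]
    rw [e.apply_mk_symm (hφ hx)]

variable [NormedSpace ℝ E]

theorem Trivialization.snd_eq_zero_iff [∀ x, Module ℝ (V x)] (e : Trivialization E (π E V))
    [e.IsLinear ℝ] {x : X} (hx : x ∈ e.baseSet) {v : V x} : (e ⟨x, v⟩).2 = 0 ↔ v = 0 :=
  (e.linearEquivAt ℝ x hx).map_eq_zero_iff

end Sections

/-! ### Sections with locally finite zeros -/

section ZeroSets

variable {E : Type*} [NormedAddCommGroup E] [NormedSpace ℝ E]
  {X : Type*} [TopologicalSpace X] [ChartedSpace E X]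
  {V : X → Type*} [TopologicalSpace (TotalSpace E V)] [∀ x, AddCommGroup (V x)]
  [∀ x, Module ℝ (V x)] [∀ x, TopologicalSpace (V x)] [FiberBundle E V] [VectorBundle ℝ E V]

variable (E V) in
theorem exists_trivializing_chart {x₀ : X} {C : Set X} (hC : C ∈ 𝓝 x₀) :
    ∃ (φ : OpenPartialHomeomorph X E) (e : Trivialization E (π E V)), e.IsLinear ℝ ∧
      x₀ ∈ φ.source ∧ φ.source ⊆ e.baseSet ∧ φ.source ⊆ C := by
  let e := trivializationAt E V x₀
  have hmem : e.baseSet ∩ C ∈ 𝓝 x₀ :=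
    inter_mem (e.open_baseSet.mem_nhds (FiberBundle.mem_baseSet_trivializationAt' x₀)) hC
  refine ⟨(chartAt E x₀).restr (e.baseSet ∩ C), e, inferInstance, ?_, ?_, ?_⟩
  · exact ⟨mem_chart_source E x₀, mem_interior_iff_mem_nhds.2 hmem⟩
  · exact fun x hx => (interior_subset hx.2).1
  · exact fun x hx => (interior_subset hx.2).2

variable [FiniteDimensional ℝ E] [T2Space X]

variable (E V) in
/-- One step of the construction of a section with isolated zeros. If `s` has finitely many zeros on
the compact set `A`, none of them on the frontier, then `A` can be enlarged by a fixed neighbourhood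
of `x₀`, keeping `s` on `A` and changing it elsewhere so that the same holds for the larger set. -/
theorem exists_nhds_finite_zeros_step (x₀ : X) :
    ∃ N ∈ 𝓝 x₀, ∀ (A : Set X) (s : (x : X) → V x), IsCompact A → IsContinuousSection E s →
      {x ∈ A | s x = 0}.Finite → {x ∈ A | s x = 0} ⊆ interior A →
      ∃ (A' : Set X) (s' : (x : X) → V x), IsCompact A' ∧ IsContinuousSection E s' ∧
        {x ∈ A' | s' x = 0}.Finite ∧ {x ∈ A' | s' x = 0} ⊆ interior A' ∧
        A ⊆ A' ∧ N ⊆ A' ∧ ∀ x ∈ A, s' x = s x := by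
  have : ProperSpace E := FiniteDimensional.proper ℝ E
  obtain ⟨φ, e, he, hx₀, hφ, -⟩ := exists_trivializing_chart E V (univ_mem : univ ∈ 𝓝 x₀)
  obtain ⟨r, hr, hrt⟩ := nhds_basis_closedBall.mem_iff.1
    (φ.open_target.mem_nhds (φ.map_source hx₀))
  have hnhds : ∀ ρ, 0 < ρ → ρ ≤ r → IsOpen (φ.symm '' ball (φ x₀) ρ) := fun ρ hρ hρr =>
    φ.symm.isOpen_image_of_subset_source isOpen_ball
      ((ball_subset_closedBall.trans (closedBall_subset_closedBall hρr)).trans hrt)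
  refine ⟨φ.symm '' ball (φ x₀) (r / 2), (hnhds _ (half_pos hr) (by linarith)).mem_nhds
    ⟨φ x₀, mem_ball_self (half_pos hr), φ.left_inv hx₀⟩, ?_⟩
  intro A s hA hs hfin hint
  let f : E → E := fun u => (e ⟨φ.symm u, s (φ.symm u)⟩).2
  have hf : ContinuousOn f φ.target := hs.continuousOn_coord hφ
  have hf0 : ∀ u ∈ φ.target, (f u = 0 ↔ s (φ.symm u) = 0) := fun u hu =>
    Trivialization.snd_eq_zero_iff e (hφ (φ.map_target hu))
  set K := closedBall (φ x₀) r with hK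
  have hN : IsOpen (φ.target ∩ φ.symm ⁻¹' Aᶜ) :=
    φ.isOpen_inter_preimage_symm hA.isClosed.isOpen_compl
  have hfinN : {u ∈ K | f u = 0 ∧ u ∉ φ.target ∩ φ.symm ⁻¹' Aᶜ}.Finite := by
    refine Set.Finite.of_finite_image (f := φ.symm) (hfin.subset ?_)
      (φ.symm.injOn.mono fun u hu => hrt hu.1)
    rintro _ ⟨u, ⟨huK, hu0, huN⟩, rfl⟩
    refine ⟨?_, (hf0 u (hrt huK)).1 hu0⟩
    by_contra hA'
    exact huN ⟨hrt huK, hA'⟩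
  have hcompN : IsCompact {u ∈ K | f u = 0 ∧ u ∈ φ.target ∩ φ.symm ⁻¹' Aᶜ} := by
    have heq : {u ∈ K | f u = 0 ∧ u ∈ φ.target ∩ φ.symm ⁻¹' Aᶜ} =
        (K ∩ f ⁻¹' {0}) ∩ (K ∩ φ.symm ⁻¹' (interior A)ᶜ) := by
      ext u
      constructor
      · rintro ⟨huK, hu0, hut, huA⟩
        exact ⟨⟨huK, hu0⟩, huK, fun h => huA (interior_subset h)⟩
      · rintro ⟨⟨huK, hu0⟩, -, huA⟩
        exact ⟨huK, hu0, hrt huK, fun h => huA (hint ⟨h, (hf0 u (hrt huK)).1 hu0⟩)⟩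
    rw [heq]
    have hKc : IsCompact K := isCompact_closedBall _ _
    have h1 : IsClosed (K ∩ f ⁻¹' {0}) :=
      (hf.mono hrt).preimage_isClosed_of_isClosed hKc.isClosed isClosed_singleton
    have h2 : IsClosed (K ∩ φ.symm ⁻¹' (interior A)ᶜ) :=
      (φ.continuousOn_symm.mono hrt).preimage_isClosed_of_isClosed hKc.isClosed
        isOpen_interior.isClosed_compl
    exact hKc.of_isClosed_subset (h1.inter h2) fun u hu => hu.1.1
  obtain ⟨g, hg, ⟨L, hL, hLN, hgL⟩, hgfin⟩ := exists_perturbation_finite_zeros φ.open_target hf hN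
    inter_subset_left (isCompact_closedBall _ _) hrt hfinN hcompN
  obtain ⟨s', hs', hoff, hcoord⟩ := hs.exists_replace hφ hg hL (hLN.trans inter_subset_left)
    fun u _ hu => hgL u hu
  have hsA : ∀ x ∈ A, s' x = s x := by
    intro x hx
    refine hoff x ?_
    rintro ⟨u, hu, rfl⟩
    exact (hLN hu).2 hx
  have hs0 : ∀ u ∈ φ.target, (s' (φ.symm u) = 0 ↔ g u = 0) := by
    intro u hu
    have := hcoord (φ.symm u) (φ.map_target hu)
    rw [φ.right_inv hu] at this
    rw [← this, Trivialization.snd_eq_zero_iff e (hφ (φ.map_target hu))]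
  -- a radius whose sphere avoids the zeros
  obtain ⟨ρ, hρ, hρn⟩ : ∃ ρ ∈ Ioo (r / 2) r, ρ ∉ (fun u => dist u (φ x₀)) '' {u ∈ K | g u = 0} := by
    have := (Ioo_infinite (show r / 2 < r by linarith)).sdiff (hgfin.image (fun u => dist u (φ x₀)))
    exact this.nonempty
  have hρK : closedBall (φ x₀) ρ ⊆ K := closedBall_subset_closedBall hρ.2.le
  have hρt := hρK.trans hrt
  have hzero : {x ∈ A ∪ φ.symm '' closedBall (φ x₀) ρ | s' x = 0} ⊆
      {x ∈ A | s x = 0} ∪ φ.symm '' ({u ∈ K | g u = 0} ∩ ball (φ x₀) ρ) := by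
    rintro x ⟨hx | ⟨u, hu, rfl⟩, hx0⟩
    · exact Or.inl ⟨hx, by rwa [hsA x hx] at hx0⟩
    · right
      have hg0 := (hs0 u (hρt hu)).1 hx0
      refine ⟨u, ⟨⟨hρK hu, hg0⟩, lt_of_le_of_ne hu fun h => hρn ⟨u, ⟨hρK hu, hg0⟩, h⟩⟩, rfl⟩
  refine ⟨A ∪ φ.symm '' closedBall (φ x₀) ρ, s', hA.union ?_, hs', ?_, ?_, subset_union_left, ?_,
    hsA⟩
  · exact (isCompact_closedBall _ _).image_of_continuousOn (φ.continuousOn_symm.mono hρt)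
  · exact (hfin.union ((hgfin.inter_of_left _).image _)).subset hzero
  · refine hzero.trans (union_subset (hint.trans (interior_mono subset_union_left)) ?_)
    refine interior_maximal ?_ (hnhds ρ (by linarith [hρ.1]) hρ.2.le) |>.trans' ?_
    · exact (image_mono ball_subset_closedBall).trans subset_union_right
    · exact image_mono inter_subset_right
  · exact (image_mono ((ball_subset_ball hρ.1.le).trans ball_subset_closedBall)).trans
      subset_union_right

/-- The zero set of the section `s` is closed and discrete if `s` is continuous: every compact set
contains finitely many zeros. -/
def HasLocallyFiniteZeros (s : (x : X) → V x) : Prop :=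
  ∀ K : Set X, IsCompact K → {x ∈ K | s x = 0}.Finite

variable (E V) in
theorem exists_isContinuousSection_hasLocallyFiniteZeros [SecondCountableTopology X] :
    ∃ s : (x : X) → V x, IsContinuousSection E s ∧ HasLocallyFiniteZeros s := by
  choose N hN hstep using exists_nhds_finite_zeros_step E V (X := X)
  obtain ⟨t, ht, hcov⟩ := TopologicalSpace.countable_cover_nhds fun x => interior_mem_nhds.2 (hN x)
  rcases isEmpty_or_nonempty X with hX | hX
  · exact ⟨fun x => 0, continuous_iff_continuousAt.2 fun x => (hX.false x).elim,
      fun K _ => Set.toFinite _⟩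
  have htne : t.Nonempty := by
    by_contra h
    rw [not_nonempty_iff_eq_empty.1 h] at hcov
    simp only [biUnion_empty] at hcov
    exact empty_ne_univ hcov
  obtain ⟨c, rfl⟩ := ht.exists_eq_range htne
  let St := {p : Set X × ((x : X) → V x) // IsCompact p.1 ∧ IsContinuousSection E p.2 ∧
    {x ∈ p.1 | p.2 x = 0}.Finite ∧ {x ∈ p.1 | p.2 x = 0} ⊆ interior p.1}
  have hnext : ∀ (i : ℕ) (p : St), ∃ q : St, p.1.1 ⊆ q.1.1 ∧ N (c i) ⊆ q.1.1 ∧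
      ∀ x ∈ p.1.1, q.1.2 x = p.1.2 x := by
    rintro i ⟨⟨A, s⟩, hA, hs, h1, h2⟩
    obtain ⟨A', s', hA', hs', h1', h2', h3⟩ := hstep (c i) A s hA hs h1 h2
    exact ⟨⟨⟨A', s'⟩, hA', hs', h1', h2'⟩, h3⟩
  choose next hnext1 hnext2 hnext3 using hnext
  have h0 : IsContinuousSection E fun x => (0 : V x) :=
    Bundle.Trivialization.continuous_zeroSection ℝ
  let p0 : St := ⟨⟨∅, fun x => 0⟩, isCompact_empty, h0, by simp, by simp⟩
  let S : ℕ → St := fun n => Nat.rec p0 (fun i p => next i p) n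
  have hmono : Monotone fun i => (S i).1.1 := monotone_nat_of_le_succ fun i => hnext1 i (S i)
  have hcover : ∀ x, ∃ i, x ∈ interior (S i).1.1 := by
    intro x
    have hx : x ∈ ⋃ y ∈ range c, interior (N y) := hcov ▸ mem_univ x
    simp only [biUnion_range, mem_iUnion] at hx
    obtain ⟨i, hi⟩ := hx
    exact ⟨i + 1, interior_mono (hnext2 i (S i)) hi⟩
  obtain ⟨s, hs, hsS⟩ := exists_isContinuousSection_of_stabilizing (fun i => (S i).2.2.1) hmono
    hcover fun i => hnext3 i (S i)
  refine ⟨s, hs, fun K hK => ?_⟩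
  obtain ⟨i, hi⟩ := hK.elim_directed_cover (fun i => interior (S i).1.1) (fun i => isOpen_interior)
    (fun x _ => mem_iUnion.2 (hcover x))
    (directed_of_isDirected_le fun i j hij => interior_mono (hmono hij))
  refine (S i).2.2.2.1.subset fun x hx => ?_
  have hxi := interior_subset (hi hx.1)
  exact ⟨hxi, by rw [← hsS i x hxi]; exact hx.2⟩

end ZeroSets

/-! ### Compact sets without relatively compact complementary components -/

section Filled

variable {X : Type*} [TopologicalSpace X]

/-- A compact set `K` is filled if every point of its complement can escape, inside a connected open
subset of the complement, from every compact set: the complement has no relatively compact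
components. -/
def IsFilledCompact (K : Set X) : Prop :=
  IsCompact K ∧ ∀ p ∉ K, ∃ C : Set X, IsOpen C ∧ IsPreconnected C ∧ p ∈ C ∧ Disjoint C K ∧
    ∀ L : Set X, IsCompact L → ∃ q ∈ C, q ∉ L

/-- Every compact set lies in a filled one, obtained by adding the relatively compact components of
its complement. The result is compact because only finitely many of these components leave a given
compact neighbourhood of the set. -/
theorem exists_isFilledCompact_superset [T2Space X] [LocallyConnectedSpace X]
    [LocallyCompactSpace X] (hopen : ∀ x : X, ¬ IsCompact (connectedComponent x)) {K : Set X}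
    (hK : IsCompact K) : ∃ K', IsFilledCompact K' ∧ K ⊆ K' := by
  classical
  let C : X → Set X := connectedComponentIn Kᶜ
  have hCo : ∀ x, IsOpen (C x) := fun x => hK.isClosed.isOpen_compl.connectedComponentIn
  have hCeq : ∀ {x y}, y ∈ C x → C x = C y := fun h => connectedComponentIn_eq h
  have hCmem : ∀ {x}, x ∉ K → x ∈ C x := fun h => mem_connectedComponentIn h
  let K' : Set X := {x | IsCompact (closure (C x))}
  have hKK' : K ⊆ K' := by
    intro x hx
    have : C x = ∅ := connectedComponentIn_eq_empty (fun h => h hx)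
    simp only [K', mem_ofPred_eq, this, closure_empty, isCompact_empty]
  have hdisj : ∀ p ∉ K', Disjoint (C p) K' := by
    intro p hp
    rw [Set.disjoint_left]
    intro y hy hyK
    exact hp (by simp only [K', mem_ofPred_eq] at hyK ⊢; rwa [hCeq hy])
  have hcl : IsClosed K' := by
    rw [← isOpen_compl_iff, isOpen_iff_mem_nhds]
    intro p hp
    exact mem_of_superset ((hCo p).mem_nhds (hCmem fun h => hp (hKK' h)))
      (Set.subset_compl_iff_disjoint_right.2 (hdisj p hp))
  obtain ⟨L, hL, hKL⟩ := exists_compact_superset hK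
  have hfr : IsCompact (frontier L) := hL.of_isClosed_subset isClosed_frontier
    hL.isClosed.frontier_subset
  have hfrK : ∀ x ∈ frontier L, x ∉ K := fun x hx h => hx.2 (hKL h)
  obtain ⟨t, ht, hcov⟩ := hfr.elim_nhds_subcover C
    fun x hx => (hCo x).mem_nhds (hCmem (hfrK x hx))
  have hsub : K' ⊆ L ∪ ⋃ x ∈ t, (if IsCompact (closure (C x)) then closure (C x) else ∅) := by
    intro y hy
    by_cases hyL : y ∈ L
    · exact Or.inl hyL
    right
    have hyK : y ∉ K := fun h => hyL (interior_subset (hKL h))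
    have hyC := hCmem hyK
    by_cases hmeet : (C y ∩ frontier L).Nonempty
    · obtain ⟨z, hzC, hzL⟩ := hmeet
      obtain ⟨x, hx, hzx⟩ := mem_iUnion₂.1 (hcov hzL)
      have hxy : C x = C y := (hCeq hzx).trans (hCeq hzC).symm
      refine mem_iUnion₂.2 ⟨x, hx, ?_⟩
      simp only [K', mem_ofPred_eq] at hy
      rw [hxy, if_pos hy]
      exact subset_closure hyC
    · -- otherwise the component stays away from `K`, so it is a compact component of `X`
      exfalso
      have h1 : C y ⊆ interior L ∪ Lᶜ := by
        intro z hz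
        by_cases hzL : z ∈ L
        · left
          by_contra hzi
          exact hmeet ⟨z, hz, subset_closure hzL, hzi⟩
        · exact Or.inr hzL
      have h2 : C y ⊆ Lᶜ := isPreconnected_connectedComponentIn.subset_right_of_subset_union
        isOpen_interior hL.isClosed.isOpen_compl
        (disjoint_compl_right.mono_left interior_subset) h1 ⟨y, hyC, hyL⟩
      have h3 : closure (C y) ⊆ Kᶜ := by
        refine (closure_mono h2).trans ?_
        rw [closure_compl]
        exact compl_subset_compl.2 hKL
      have h4 : closure (C y) ⊆ C y :=
        isPreconnected_connectedComponentIn.closure.subset_connectedComponentIn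
          (subset_closure hyC) h3
      have h5 : IsClopen (C y) := ⟨isClosed_of_closure_subset h4, hCo y⟩
      refine hopen y (hy.of_isClosed_subset isClosed_connectedComponent ?_)
      exact (h5.connectedComponent_subset hyC).trans subset_closure
  have hcomp : IsCompact K' := by
    refine (hL.union (t.isCompact_biUnion fun x _ => ?_)).of_isClosed_subset hcl hsub
    split_ifs with h
    · exact h
    · exact isCompact_empty
  refine ⟨K', ⟨hcomp, fun p hp => ⟨C p, hCo p, isPreconnected_connectedComponentIn,
    hCmem fun h => hp (hKK' h), hdisj p hp, fun L hL => ?_⟩⟩, hKK'⟩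
  by_contra h
  push Not at h
  exact hp (hL.of_isClosed_subset isClosed_closure (closure_minimal h hL.isClosed))

end Filled

/-! ### Moving zeros to infinity -/

section MovingZeros

variable {E : Type*} {X : Type*} [TopologicalSpace X] {V : X → Type*}
  [TopologicalSpace (TotalSpace E V)] [∀ x, AddCommGroup (V x)]

variable (E V) in
/-- Inside `C`, a zero at `p` can be traded for a zero at `q`: every continuous section with locally
finite zeros can be modified inside `C` so that `p` is no longer a zero, unless `p = q`, and at
most `q` is a new zero. -/
def CanMoveZero (C : Set X) (p q : X) : Prop :=
  ∀ s : (x : X) → V x, IsContinuousSection E s → HasLocallyFiniteZeros s →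
    ∃ s' : (x : X) → V x, IsContinuousSection E s' ∧ HasLocallyFiniteZeros s' ∧
      (∀ x ∉ C, s' x = s x) ∧ ∀ x, s' x = 0 → x = q ∨ (x ≠ p ∧ s x = 0)

theorem CanMoveZero.trans {C : Set X} {p q r : X} (hpq : CanMoveZero E V C p q)
    (hqr : CanMoveZero E V C q r) : CanMoveZero E V C p r := by
  intro s hs hfin
  obtain ⟨s₁, hs₁, hfin₁, hoff₁, hz₁⟩ := hpq s hs hfin
  obtain ⟨s₂, hs₂, hfin₂, hoff₂, hz₂⟩ := hqr s₁ hs₁ hfin₁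
  refine ⟨s₂, hs₂, hfin₂, fun x hx => (hoff₂ x hx).trans (hoff₁ x hx), fun x hx => ?_⟩
  rcases hz₂ x hx with h | ⟨hxq, hx0⟩
  · exact Or.inl h
  · exact Or.inr ((hz₁ x hx0).resolve_left hxq)

variable [NormedAddCommGroup E] [NormedSpace ℝ E] [FiniteDimensional ℝ E]
  [∀ x, Module ℝ (V x)] [∀ x, TopologicalSpace (V x)] [FiberBundle E V] [VectorBundle ℝ E V]
  [T2Space X] [ChartedSpace E X]

/-- Nearby zeros can be traded for each other: the points lie in a chart ball with no zeros on its
boundary, and inside it the section is replaced by a cone with the prescribed vertex. -/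
theorem exists_nhds_canMoveZero {C : Set X} {x₀ : X} (hC : C ∈ 𝓝 x₀) :
    ∃ N ∈ 𝓝 x₀, ∀ p ∈ N, ∀ q ∈ N, CanMoveZero E V C p q := by
  have : ProperSpace E := FiniteDimensional.proper ℝ E
  obtain ⟨φ, e, he, hx₀, hφ, hφC⟩ := exists_trivializing_chart E V hC
  obtain ⟨r, hr, hrt⟩ := nhds_basis_closedBall.mem_iff.1
    (φ.open_target.mem_nhds (φ.map_source hx₀))
  have hbt : ball (φ x₀) (r / 4) ⊆ φ.target :=
    (ball_subset_closedBall.trans (closedBall_subset_closedBall (by linarith))).trans hrt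
  refine ⟨φ.symm '' ball (φ x₀) (r / 4), (φ.symm.isOpen_image_of_subset_source isOpen_ball
    hbt).mem_nhds ⟨φ x₀, mem_ball_self (by linarith), φ.left_inv hx₀⟩, ?_⟩
  rintro _ ⟨u, hu, rfl⟩ _ ⟨a, ha, rfl⟩ s hs hfin
  let f : E → E := fun u => (e ⟨φ.symm u, s (φ.symm u)⟩).2
  have hf : ContinuousOn f φ.target := hs.continuousOn_coord hφ
  have hf0 : ∀ u ∈ φ.target, (f u = 0 ↔ s (φ.symm u) = 0) := fun u hu =>
    Trivialization.snd_eq_zero_iff e (hφ (φ.map_target hu))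
  have hZ : {v ∈ closedBall (φ x₀) r | f v = 0}.Finite := by
    refine Set.Finite.of_finite_image (f := φ.symm) ((hfin _
      ((isCompact_closedBall (φ x₀) r).image_of_continuousOn
        (φ.continuousOn_symm.mono hrt))).subset ?_) (φ.symm.injOn.mono fun u hu => hrt hu.1)
    rintro _ ⟨v, ⟨hv, hv0⟩, rfl⟩
    exact ⟨⟨v, hv, rfl⟩, (hf0 v (hrt hv)).1 hv0⟩
  -- a ball around `a` that contains `u`, with no zeros on its boundary
  obtain ⟨ρ, hρ, hρn⟩ : ∃ ρ ∈ Ioo (r / 2) (3 * r / 4),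
      ρ ∉ (fun v => dist v a) '' {v ∈ closedBall (φ x₀) r | f v = 0} :=
    ((Ioo_infinite (show r / 2 < 3 * r / 4 by linarith)).sdiff (hZ.image _)).nonempty
  have hρr : closedBall a ρ ⊆ closedBall (φ x₀) r :=
    closedBall_subset_closedBall' (by linarith [mem_ball.1 ha, hρ.2])
  have hρt := hρr.trans hrt
  obtain ⟨g, hg, hgoff, hg0⟩ := exists_cone_extension hf (by linarith [hρ.1]) hρt
    fun v hv hv0 => hρn ⟨v, ⟨hρr (sphere_subset_closedBall hv), hv0⟩, hv⟩
  obtain ⟨s', hs', hoff, hcoord⟩ := hs.exists_replace hφ hg (isCompact_closedBall a ρ) hρt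
    fun v _ hv => hgoff v hv
  have hzero : ∀ x, s' x = 0 → x = φ.symm a ∨ (x ≠ φ.symm u ∧ s x = 0) := by
    intro x hx
    by_cases hxb : x ∈ φ.symm '' closedBall a ρ
    · left
      obtain ⟨v, hv, rfl⟩ := hxb
      have h1 := hcoord (φ.symm v) (φ.map_target (hρt hv))
      rw [φ.right_inv (hρt hv), (Trivialization.snd_eq_zero_iff e
        (hφ (φ.map_target (hρt hv)))).2 hx] at h1
      rw [hg0 v hv h1.symm]
    · right
      refine ⟨?_, by rwa [hoff x hxb] at hx⟩
      rintro rfl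
      refine hxb ⟨u, ?_, rfl⟩
      have := dist_triangle_right u a (φ x₀)
      have h1 := mem_ball.1 hu
      have h2 := mem_ball.1 ha
      rw [mem_closedBall]
      linarith [hρ.1]
  refine ⟨s', hs', fun K hK => ?_, fun x hx => hoff x ?_, hzero⟩
  · refine ((hfin K hK).insert (φ.symm a)).subset fun x hx => ?_
    rcases hzero x hx.2 with h | h
    · exact Or.inl h
    · exact Or.inr ⟨hx.1, h.2⟩
  · rintro ⟨v, hv, rfl⟩
    exact hx (hφC (φ.map_target (hρt hv)))

theorem canMoveZero_of_isPreconnected {C : Set X} (hCo : IsOpen C) (hC : IsPreconnected C) {p q : X}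
    (hp : p ∈ C) (hq : q ∈ C) : CanMoveZero E V C p q := by
  refine hC.induction₂' (CanMoveZero E V C) (fun x hx => ?_)
    (fun x y z _ _ _ hxy hyz => hxy.trans hyz) hp hq
  obtain ⟨N, hN, hmove⟩ := exists_nhds_canMoveZero (E := E) (V := V) (hCo.mem_nhds hx)
  filter_upwards [mem_nhdsWithin_of_mem_nhds hN] with y hy
  exact ⟨hmove x (mem_of_mem_nhds hN) y hy, hmove y hy x (mem_of_mem_nhds hN)⟩

/-- The finitely many zeros in `L` can be moved out of `L` without changing the section on the
filled compact set `K`, since each of them can escape inside the complement of `K`. -/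
theorem exists_clear_zeros {K L : Set X} (hK : IsFilledCompact K) (hL : IsCompact L)
    {s : (x : X) → V x} (hs : IsContinuousSection E s) (hfin : HasLocallyFiniteZeros s)
    (hsK : ∀ x ∈ K, s x ≠ 0) :
    ∃ s' : (x : X) → V x, IsContinuousSection E s' ∧ HasLocallyFiniteZeros s' ∧
      (∀ x ∈ K, s' x = s x) ∧ ∀ x ∈ L, s' x ≠ 0 := by
  induction hn : {x ∈ L | s x = 0}.ncard using Nat.strong_induction_on generalizing s with
  | _ n ih =>
    rcases {x ∈ L | s x = 0}.eq_empty_or_nonempty with he | ⟨p, hpL, hp0⟩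
    · exact ⟨s, hs, hfin, fun _ _ => rfl, fun x hx h =>
        eq_empty_iff_forall_notMem.1 he x ⟨hx, h⟩⟩
    obtain ⟨C, hCo, hC, hpC, hCK, hesc⟩ := hK.2 p fun h => hsK p h hp0
    obtain ⟨q, hqC, hqL⟩ := hesc L hL
    obtain ⟨s₁, hs₁, hfin₁, hoff, hz⟩ :=
      canMoveZero_of_isPreconnected (E := E) (V := V) hCo hC hpC hqC s hs hfin
    have hK₁ : ∀ x ∈ K, s₁ x = s x := fun x hx => hoff x fun h => Set.disjoint_left.1 hCK h hx
    have hlt : {x ∈ L | s₁ x = 0}.ncard < n := by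
      rw [← hn]
      refine Set.ncard_lt_ncard ⟨fun x hx => ?_, fun h => ?_⟩ (hfin L hL)
      · rcases hz x hx.2 with rfl | h
        · exact (hqL hx.1).elim
        · exact ⟨hx.1, h.2⟩
      · rcases hz p (h ⟨hpL, hp0⟩).2 with rfl | h
        · exact hqL hpL
        · exact h.1 rfl
    obtain ⟨s', hs', hfin', hK', hL'⟩ := ih _ hlt hs₁ hfin₁
      (fun x hx => by rw [hK₁ x hx]; exact hsK x hx) rfl
    exact ⟨s', hs', hfin', fun x hx => (hK' x hx).trans (hK₁ x hx), hL'⟩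

variable (E V) in
/-- A vector bundle whose rank is the dimension of its base has a nowhere vanishing continuous
section if no component of the base is compact. -/
theorem exists_isContinuousSection_ne_zero [SecondCountableTopology X]
    (hopen : ∀ x : X, ¬ IsCompact (connectedComponent x)) :
    ∃ s : (x : X) → V x, IsContinuousSection E s ∧ ∀ x, s x ≠ 0 := by
  have : ProperSpace E := FiniteDimensional.proper ℝ E
  have : LocallyCompactSpace X := ChartedSpace.locallyCompactSpace E X
  have : LocallyConnectedSpace X := ChartedSpace.locallyConnectedSpace E X
  obtain ⟨s₀, hs₀, hfin₀⟩ := exists_isContinuousSection_hasLocallyFiniteZeros E V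
  let T : CompactExhaustion X := default
  let St := {p : Set X × ((x : X) → V x) // IsFilledCompact p.1 ∧ IsContinuousSection E p.2 ∧
    HasLocallyFiniteZeros p.2 ∧ ∀ x ∈ p.1, p.2 x ≠ 0}
  have hnext : ∀ (i : ℕ) (p : St), ∃ q : St, p.1.1 ⊆ q.1.1 ∧ T i ⊆ q.1.1 ∧
      ∀ x ∈ p.1.1, q.1.2 x = p.1.2 x := by
    rintro i ⟨⟨K, s⟩, hK, hs, hfin, hsK⟩
    obtain ⟨L, hL, hKL⟩ := exists_isFilledCompact_superset hopen (hK.1.union (T.isCompact i))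
    obtain ⟨s', hs', hfin', hK', hL'⟩ := exists_clear_zeros hK hL.1 hs hfin hsK
    exact ⟨⟨⟨L, s'⟩, hL, hs', hfin', hL'⟩, subset_union_left.trans hKL,
      subset_union_right.trans hKL, hK'⟩
  choose next hnext1 hnext2 hnext3 using hnext
  have hempty : IsFilledCompact (∅ : Set X) := by
    refine ⟨isCompact_empty, fun p _ => ⟨connectedComponent p, isOpen_connectedComponent,
      isPreconnected_connectedComponent, mem_connectedComponent, disjoint_empty _, fun L hL => ?_⟩⟩
    by_contra h
    push Not at h
    exact hopen p (hL.of_isClosed_subset isClosed_connectedComponent h)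
  let p0 : St := ⟨⟨∅, s₀⟩, hempty, hs₀, hfin₀, by simp⟩
  let S : ℕ → St := fun n => Nat.rec p0 (fun i p => next i p) n
  have hcover : ∀ x, ∃ i, x ∈ interior (S i).1.1 := by
    intro x
    obtain ⟨i, hi⟩ := T.exists_mem x
    exact ⟨i + 2, interior_mono (hnext2 (i + 1) (S (i + 1))) (T.subset_interior_succ i hi)⟩
  obtain ⟨s, hs, hsS⟩ := exists_isContinuousSection_of_stabilizing (fun i => (S i).2.2.1)
    (monotone_nat_of_le_succ fun i => hnext1 i (S i)) hcover fun i => hnext3 i (S i)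
  refine ⟨s, hs, fun x => ?_⟩
  obtain ⟨i, hi⟩ := hcover x
  rw [hsS i x (interior_subset hi)]
  exact (S i).2.2.2.2 x (interior_subset hi)

end MovingZeros

/-! ### Smooth 2-forms evaluated on vector fields -/

theorem contDiff_alternating_apply_two (E : Type*) [NormedAddCommGroup E] [NormedSpace ℝ E] :
    ContDiff ℝ ∞ fun p : (E [⋀^Fin 2]→L[ℝ] ℝ) × E × E => p.1 ![p.2.1, p.2.2] := by
  -- the curried form, as a continuous linear map
  let B : (E [⋀^Fin 2]→L[ℝ] ℝ) →L[ℝ] (E →L[ℝ] E →L[ℝ] ℝ) :=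
    ((continuousMultilinearCurryFin1
        ℝ E ℝ).toContinuousLinearEquiv.toContinuousLinearMap.postcomp E) ∘L
      ((continuousMultilinearCurryLeftEquiv ℝ
        (fun _ : Fin 2 => E) ℝ).toContinuousLinearEquiv.toContinuousLinearMap) ∘L
      (ContinuousAlternatingMap.toContinuousMultilinearMapCLM ℝ)
  have hB : ∀ A v w, B A v w = A ![v, w] := fun A v w => by
    simp [B]
  simp_rw [← hB]
  fun_prop

section Forms

variable {n : ℕ} {X : Type*} [TopologicalSpace X] [ChartedSpace (EuclideanSpace ℝ (Fin n)) X]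

theorem Form.IsSmooth.contMDiffAt_inChart {Ω : Form n 2 X} (hΩ : Ω.IsSmooth)
    [IsManifold (𝓡 n) ∞ X] (x₀ : X) :
    ContMDiffAt (𝓡 n) 𝓘(ℝ, EuclideanSpace ℝ (Fin n) [⋀^Fin 2]→L[ℝ] ℝ) ∞
      (fun x => Ω.inChart x₀ (extChartAt (𝓡 n) x₀ x)) x₀ := by
  have h1 : ContDiffAt ℝ ∞ (Ω.inChart x₀) (extChartAt (𝓡 n) x₀ x₀) :=
    (hΩ x₀).contDiffAt ((isOpen_extChartAt_target x₀).mem_nhds (mem_extChartAt_target x₀))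
  exact h1.contMDiffAt.comp x₀ contMDiffAt_extChartAt

variable [IsManifold (𝓡 n) ∞ X]

/-- The coordinates of a tangent vector at a point near `x₀` in the preferred chart at `x₀`. -/
noncomputable def tangentCoord (x₀ : X) {x : X} (v : TangentSpace (𝓡 n) x) :
    EuclideanSpace ℝ (Fin n) :=
  (trivializationAt (EuclideanSpace ℝ (Fin n)) (TangentSpace (𝓡 n)) x₀ ⟨x, v⟩).2

theorem tangentCoord_eq_mfderiv {x₀ x : X}
    (hx : x ∈ (chartAt (EuclideanSpace ℝ (Fin n)) x₀).source) (v : TangentSpace (𝓡 n) x) :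
    tangentCoord x₀ v = mfderiv (𝓡 n) (𝓡 n) (extChartAt (𝓡 n) x₀) x v := by
  have h := DFunLike.congr_fun
    (TangentBundle.continuousLinearMapAt_trivializationAt (I := 𝓡 n) hx) v
  refine Eq.trans ?_ h
  exact (congrFun (Bundle.Trivialization.coe_linearMapAt_of_mem (R := ℝ)
    (trivializationAt (EuclideanSpace ℝ (Fin n)) (TangentSpace (𝓡 n)) x₀) hx) v).symm

/-- The values of a form in terms of its expression in a preferred chart. -/
theorem Form.apply_eq_inChart (Ω : Form n 2 X) {x₀ x : X}
    (hx : x ∈ (chartAt (EuclideanSpace ℝ (Fin n)) x₀).source) (v w : TangentSpace (𝓡 n) x) :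
    Ω x ![v, w] =
      Ω.inChart x₀ (extChartAt (𝓡 n) x₀ x) ![tangentCoord x₀ v, tangentCoord x₀ w] := by
  have hxs : x ∈ (extChartAt (𝓡 n) x₀).source := by rwa [extChartAt_source]
  obtain ⟨u, hu, rfl⟩ : ∃ u ∈ (extChartAt (𝓡 n) x₀).target, (extChartAt (𝓡 n) x₀).symm u = x :=
    ⟨_, (extChartAt (𝓡 n) x₀).map_source hxs, (extChartAt (𝓡 n) x₀).left_inv hxs⟩
  rw [(extChartAt (𝓡 n) x₀).right_inv hu]
  have hinv : ∀ v : TangentSpace (𝓡 n) ((extChartAt (𝓡 n) x₀).symm u),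
      v = mfderiv (𝓡 n) (𝓡 n) (extChartAt (𝓡 n) x₀).symm u (tangentCoord x₀ v) := by
    intro v
    rw [tangentCoord_eq_mfderiv hx]
    have h := mfderivWithin_extChartAt_symm_comp_mfderiv_extChartAt (I := 𝓡 n) hu
    rw [ModelWithCorners.range_eq_univ, mfderivWithin_univ] at h
    exact (DFunLike.congr_fun h v).symm
  change _ = Ω _ (fun i => mfderiv (𝓡 n) (𝓡 n) (extChartAt (𝓡 n) x₀).symm u
    (![tangentCoord x₀ v, tangentCoord x₀ w] i))
  congr 1
  ext1 i
  fin_cases i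
  · exact hinv v
  · exact hinv w

theorem Form.eventuallyEq_inChart (Ω : Form n 2 X) (v w : (x : X) → TangentSpace (𝓡 n) x)
    (x₀ : X) : (fun x => Ω x ![v x, w x]) =ᶠ[𝓝 x₀] fun x =>
      Ω.inChart x₀ (extChartAt (𝓡 n) x₀ x) ![tangentCoord x₀ (v x), tangentCoord x₀ (w x)] := by
  filter_upwards [(chartAt (EuclideanSpace ℝ (Fin n)) x₀).open_source.mem_nhds
    (mem_chart_source _ x₀)] with x hx
  exact Ω.apply_eq_inChart hx _ _

theorem Form.IsSmooth.contMDiffAt_apply {Ω : Form n 2 X} (hΩ : Ω.IsSmooth)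
    {v w : (x : X) → TangentSpace (𝓡 n) x} {x₀ : X}
    (hv : ContMDiffAt (𝓡 n) (𝓡 n).tangent ∞ (fun x => (⟨x, v x⟩ : TangentBundle (𝓡 n) X)) x₀)
    (hw : ContMDiffAt (𝓡 n) (𝓡 n).tangent ∞ (fun x => (⟨x, w x⟩ : TangentBundle (𝓡 n) X)) x₀) :
    ContMDiffAt (𝓡 n) 𝓘(ℝ, ℝ) ∞ (fun x => Ω x ![v x, w x]) x₀ := by
  refine ContMDiffAt.congr_of_eventuallyEq ?_ (Ω.eventuallyEq_inChart v w x₀)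
  exact (contDiff_alternating_apply_two _).contDiffAt.comp_contMDiffAt
    ((hΩ.contMDiffAt_inChart x₀).prodMk_space
    (((contMDiffAt_section x₀).1 hv).prodMk_space ((contMDiffAt_section x₀).1 hw)))

theorem continuousAt_tangentCoord {v : (x : X) → TangentSpace (𝓡 n) x} {x₀ : X}
    (hv : ContinuousAt (fun x => (⟨x, v x⟩ : TangentBundle (𝓡 n) X)) x₀) :
    ContinuousAt (fun x => tangentCoord x₀ (v x)) x₀ :=
  ((FiberBundle.continuousAt_totalSpace _ _).1 hv).2

theorem Form.IsSmooth.continuousAt_apply {Ω : Form n 2 X} (hΩ : Ω.IsSmooth)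
    {v w : (x : X) → TangentSpace (𝓡 n) x} {x₀ : X}
    (hv : ContinuousAt (fun x => (⟨x, v x⟩ : TangentBundle (𝓡 n) X)) x₀)
    (hw : ContinuousAt (fun x => (⟨x, w x⟩ : TangentBundle (𝓡 n) X)) x₀) :
    ContinuousAt (fun x => Ω x ![v x, w x]) x₀ := by
  refine ContinuousAt.congr ?_ (Ω.eventuallyEq_inChart v w x₀).symm
  exact (contDiff_alternating_apply_two _).continuous.continuousAt.comp
    ((hΩ.contMDiffAt_inChart x₀).continuousAt.prodMk
      ((continuousAt_tangentCoord hv).prodMk (continuousAt_tangentCoord hw)))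

end Forms

/-! ### Linear algebra of a symplectic frame -/

section LinearAlgebra

variable {M : Type*} [AddCommGroup M] [Module ℝ M]

/-- A continuous alternating 2-form as a bilinear map. -/
noncomputable def alternatingBilin [TopologicalSpace M] (A : M [⋀^Fin 2]→L[ℝ] ℝ) :
    M →ₗ[ℝ] M →ₗ[ℝ] ℝ :=
  have h0 (a v w : M) : Function.update ![v, w] 0 a = ![a, w] := by
    ext i; fin_cases i <;> rfl
  have h1 (a v w : M) : Function.update ![v, w] 1 a = ![v, a] := by
    ext i; fin_cases i <;> rfl
  LinearMap.mk₂ ℝ (fun v w => A ![v, w])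
    (fun v v' w => by simpa only [h0] using A.map_update_add ![v, w] 0 v v')
    (fun c v w => by simpa only [h0] using A.map_update_smul ![v, w] 0 c v)
    (fun v w w' => by simpa only [h1] using A.map_update_add ![v, w] 1 w w')
    (fun c v w => by simpa only [h1] using A.map_update_smul ![v, w] 1 c w)

theorem alternatingBilin_isAlt [TopologicalSpace M] (A : M [⋀^Fin 2]→L[ℝ] ℝ) :
    (alternatingBilin A).IsAlt := fun v =>
  A.map_eq_zero_of_eq ![v, v] (i := 0) (j := 1) rfl (by decide)

variable {B : M →ₗ[ℝ] M →ₗ[ℝ] ℝ}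

/-- The relations satisfied by a symplectic frame of a four-dimensional space. -/
def IsSymplecticFrame (B : M →ₗ[ℝ] M →ₗ[ℝ] ℝ) (V W : Fin 2 → M) : Prop :=
  ∀ i j, B (V i) (W j) = (if i = j then 1 else 0) ∧ B (V i) (V j) = 0 ∧ B (W i) (W j) = 0

/-- A symplectic frame is a basis, with coordinates given by the pairings with its members. -/
theorem IsSymplecticFrame.expansion {V W : Fin 2 → M} (h : IsSymplecticFrame B V W)
    (hB : B.IsAlt) (hdim : Module.finrank ℝ M = 4) (v : M) :
    v = (B v (W 0) • V 0 + B v (W 1) • V 1) - (B v (V 0) • W 0 + B v (V 1) • W 1) := by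
  have hWV : ∀ i j, B (W i) (V j) = -(if j = i then 1 else 0) := fun i j => by
    rw [← (h j i).1, hB.neg]
  have : Module.Finite ℝ M := Module.finite_of_finrank_pos (by omega)
  let F : M →ₗ[ℝ] (Fin 4 → ℝ) :=
    LinearMap.pi ![B.flip (W 0), B.flip (W 1), B.flip (V 0), B.flip (V 1)]
  have hF : ∀ c : Fin 4 → ℝ, F ((c 0 • V 0 + c 1 • V 1) - (c 2 • W 0 + c 3 • W 1)) = c := by
    intro c
    ext i
    fin_cases i <;> simp [F, (h _ _).1, (h _ _).2.1, (h _ _).2.2, hWV]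
  have hinj : Function.Injective F :=
    (LinearMap.injective_iff_surjective_of_finrank_eq_finrank (by simp [hdim])).2
      fun c => ⟨_, hF c⟩
  apply hinj
  exact (hF (F v)).symm

/-- The complex structure that sends `V 0` to `V 1` and `W 1` to `W 0` for a symplectic frame
`V, W` of `B`. -/
noncomputable def frameRotation (B : M →ₗ[ℝ] M →ₗ[ℝ] ℝ) (V W : Fin 2 → M) : M →ₗ[ℝ] M :=
  ((B.flip (W 0)).smulRight (V 1) - (B.flip (W 1)).smulRight (V 0)) +
    ((B.flip (V 0)).smulRight (W 1) - (B.flip (V 1)).smulRight (W 0))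

theorem frameRotation_apply (V W : Fin 2 → M) (v : M) :
    frameRotation B V W v =
      (B v (W 0) • V 1 - B v (W 1) • V 0) + (B v (V 0) • W 1 - B v (V 1) • W 0) := rfl

theorem IsSymplecticFrame.frameRotation_sq {V W : Fin 2 → M} (h : IsSymplecticFrame B V W)
    (hB : B.IsAlt) (hdim : Module.finrank ℝ M = 4) (v : M) :
    frameRotation B V W (frameRotation B V W v) = -v := by
  have hWV : ∀ i j, B (W i) (V j) = -(if j = i then 1 else 0) := fun i j => by
    rw [← (h j i).1, hB.neg]
  rw [frameRotation_apply _ _ (frameRotation B V W v), frameRotation_apply _ _ v]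
  conv_rhs => rw [h.expansion hB hdim v]
  simp [(h _ _).1, (h _ _).2.1, (h _ _).2.2, hWV]
  module

theorem IsSymplecticFrame.frameRotation_antiInvariant {V W : Fin 2 → M}
    (h : IsSymplecticFrame B V W) (hB : B.IsAlt) (hdim : Module.finrank ℝ M = 4) (v w : M) :
    B (frameRotation B V W v) (frameRotation B V W w) = -B v w := by
  have hWV : ∀ i j, B (W i) (V j) = -(if j = i then 1 else 0) := fun i j => by
    rw [← (h j i).1, hB.neg]
  have h1 : B v w = (B v (V 0) * B w (W 0) - B v (W 0) * B w (V 0)) +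
      (B v (V 1) * B w (W 1) - B v (W 1) * B w (V 1)) := by
    conv_lhs => rw [h.expansion hB hdim w]
    simp
    ring
  rw [frameRotation_apply, frameRotation_apply, h1]
  simp [(h _ _).1, (h _ _).2.1, (h _ _).2.2, hWV]
  ring

section ComplexStructure

variable {J : M →ₗ[ℝ] M}

theorem apply_complexStructure_left (hJ : ∀ v, J (J v) = -v) (hA : ∀ v w, B (J v) (J w) = -B v w)
    (v w : M) : B (J v) w = B v (J w) := by
  have h1 := hA v (J w)
  rw [hJ] at h1
  simpa using h1

theorem apply_complexStructure_self (hB : B.IsAlt) (hJ : ∀ v, J (J v) = -v)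
    (hA : ∀ v w, B (J v) (J w) = -B v w) (v : M) : B v (J v) = 0 := by
  have h1 := apply_complexStructure_left hJ hA v v
  have h2 := hB.neg v (J v)
  linarith

/-- If `B` is anti-invariant under `J`, it is the real part of the complex area form
`B v w - i * B (J v) w`; a complex basis of area one then gives a symplectic frame. -/
theorem isSymplecticFrame_of_complexStructure (hB : B.IsAlt) (hJ : ∀ v, J (J v) = -v)
    (hA : ∀ v w, B (J v) (J w) = -B v w) {v w : M} (h1 : B v w = 1) (h2 : B (J v) w = 0) :
    IsSymplecticFrame B ![v, J v] ![w, -J w] := by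
  have h3 := apply_complexStructure_self hB hJ hA
  have h4 := apply_complexStructure_left hJ hA
  have h5 : B v (J w) = 0 := by rw [← h4, h2]
  intro i j
  fin_cases i <;> fin_cases j <;> simp [hA, h1, h2, h3, h4, h5, hJ, hB _]

end ComplexStructure

end LinearAlgebra

/-! ### Smooth vector fields and endomorphisms determined by a 2-form -/

section VectorFields

variable {n : ℕ} {X : Type*} [TopologicalSpace X] [ChartedSpace (EuclideanSpace ℝ (Fin n)) X]

theorem contMDiffAt_clm_of_apply {F G : Type*} [NormedAddCommGroup F] [NormedSpace ℝ F]
    [FiniteDimensional ℝ F] [NormedAddCommGroup G] [NormedSpace ℝ G] {f : X → F →L[ℝ] G} {x₀ : X}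
    (hf : ∀ u, ContMDiffAt (𝓡 n) 𝓘(ℝ, G) ∞ (fun x => f x u) x₀) :
    ContMDiffAt (𝓡 n) 𝓘(ℝ, F →L[ℝ] G) ∞ f x₀ := by
  let b := Module.finBasis ℝ F
  let c : ∀ i, F →L[ℝ] ℝ := fun i => LinearMap.toContinuousLinearMap (b.coord i)
  have heq : f = fun x => ∑ i, ContinuousLinearMap.smulRightL ℝ F G (c i) (f x (b i)) := by
    funext x
    ext u
    rw [← congrArg (f x) (b.sum_repr u), map_sum]
    simp [c]
  rw [heq]
  exact contMDiffAt_finsetSum fun i _ =>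
    (ContinuousLinearMap.smulRightL ℝ F G (c i)).contMDiff.contMDiffAt.comp x₀ (hf (b i))

variable [IsManifold (𝓡 n) ∞ X]

/-- Existence of a nowhere vanishing smooth vector field from that of a continuous one `s`. The
condition `0 < Ω(s, V)` on `V` is convex, is preserved by small perturbations and forces `V ≠ 0`, so
that a partition of unity applies and no metric is needed. -/
theorem exists_smooth_vectorField_ne_zero [T2Space X] [SecondCountableTopology X] {Ω : Form n 2 X}
    (hΩ : IsSymplectic Ω) {s : (x : X) → TangentSpace (𝓡 n) x}
    (hs : IsContinuousSection (EuclideanSpace ℝ (Fin n)) s) (hs0 : ∀ x, s x ≠ 0) :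
    ∃ V : (x : X) → TangentSpace (𝓡 n) x, IsSmoothVectorField V ∧ ∀ x, V x ≠ 0 := by
  let B := fun x => alternatingBilin (Ω x)
  have : LocallyCompactSpace X := ChartedSpace.locallyCompactSpace (EuclideanSpace ℝ (Fin n)) X
  have hloc : ∀ x₀ : X, ∃ U ∈ 𝓝 x₀, ∃ w : (x : X) → TangentSpace (𝓡 n) x,
      ContMDiffOn (𝓡 n) (𝓡 n).tangent ∞ (fun x => (⟨x, w x⟩ : TangentBundle (𝓡 n) X)) U ∧
        ∀ y ∈ U, 0 < B y (s y) (w y) := by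
    intro x₀
    obtain ⟨w₀, hw₀⟩ : ∃ w, 0 < B x₀ (s x₀) w := by
      by_contra hcon
      push Not at hcon
      refine hs0 x₀ (hΩ.nondegenerate x₀ _ fun w => le_antisymm (hcon w) ?_)
      have := hcon (-w)
      rw [map_neg] at this
      exact neg_nonpos.1 this
    obtain ⟨U, hU, hext⟩ := FiberBundle.exists_contMDiffOn_extend (k := ∞) (𝓡 n)
      (EuclideanSpace ℝ (Fin n)) w₀
    have hext₀ : ContMDiffAt (𝓡 n) (𝓡 n).tangent ∞ _ x₀ := hext.contMDiffAt hU
    have hcont := hΩ.smooth.continuousAt_apply hs.continuousAt hext₀.continuousAt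
    have hpos : ∀ᶠ y in 𝓝 x₀, 0 < B y (s y)
        (FiberBundle.extend (EuclideanSpace ℝ (Fin n)) w₀ y) := by
      refine hcont.eventually_const_lt ?_
      change 0 < B x₀ (s x₀) (FiberBundle.extend (EuclideanSpace ℝ (Fin n)) w₀ x₀)
      rwa [FiberBundle.extend_apply_self]
    exact ⟨_, inter_mem hU hpos, _, hext.mono inter_subset_left, fun y hy => hy.2⟩
  obtain ⟨V, hV⟩ := exists_contMDiffSection_forall_mem_convex_of_local (n := ⊤) (𝓡 n)
    (F_fiber := EuclideanSpace ℝ (Fin n)) (fun x : X => TangentSpace (𝓡 n) x)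
    (fun x => {w | 0 < B x (s x) w})
    (fun x => (convex_Ioi (0 : ℝ)).is_linear_preimage (B x (s x)).isLinear) hloc
  refine ⟨V, V.contMDiff, fun x h => ?_⟩
  have := hV x
  simp only [mem_ofPred_eq, h, map_zero, lt_irrefl] at this

/-- The vector field `W` completes `V` to a basis on which the complex area form
`Ω(·, ·) - i Ω(J ·, ·)` equals one. The condition on `W` is affine, so local solutions suffice. -/
theorem AlmostComplexStructure.exists_smooth_vectorField_apply_eq [T2Space X]
    [SecondCountableTopology X] {Ω : Form n 2 X} (hΩ : IsSymplectic Ω)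
    (J : AlmostComplexStructure n X) (hJ : J.IsAntiInvariant Ω)
    {V : (x : X) → TangentSpace (𝓡 n) x} (hV : IsSmoothVectorField V) (hV0 : ∀ x, V x ≠ 0) :
    ∃ W : (x : X) → TangentSpace (𝓡 n) x, IsSmoothVectorField W ∧
      ∀ x, Ω x ![V x, W x] = 1 ∧ Ω x ![J.toFun x (V x), W x] = 0 := by
  let B := fun x => alternatingBilin (Ω x)
  have : LocallyCompactSpace X := ChartedSpace.locallyCompactSpace (EuclideanSpace ℝ (Fin n)) X
  have hJV : IsSmoothVectorField fun x => J.toFun x (V x) := ContMDiff.clm_bundle_apply J.smooth hV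
  have hloc : ∀ x₀ : X, ∃ U ∈ 𝓝 x₀, ∃ w : (x : X) → TangentSpace (𝓡 n) x,
      ContMDiffOn (𝓡 n) (𝓡 n).tangent ∞ (fun x => (⟨x, w x⟩ : TangentBundle (𝓡 n) X)) U ∧
        ∀ y ∈ U, B y (V y) (w y) = 1 ∧ B y (J.toFun y (V y)) (w y) = 0 := by
    intro x₀
    obtain ⟨w₀, hw₀⟩ : ∃ w, B x₀ (V x₀) w ≠ 0 := by
      by_contra hcon
      push Not at hcon
      exact hV0 x₀ (hΩ.nondegenerate x₀ _ hcon)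
    obtain ⟨U, hU, hext⟩ := FiberBundle.exists_contMDiffOn_extend (k := ∞) (𝓡 n)
      (EuclideanSpace ℝ (Fin n)) w₀
    obtain ⟨U', hU'U, hU'o, hxU'⟩ := mem_nhds_iff.1 hU
    set w := FiberBundle.extend (EuclideanSpace ℝ (Fin n)) w₀ with hw
    have hw' : ∀ y ∈ U', ContMDiffAt (𝓡 n) (𝓡 n).tangent ∞
        (fun x => (⟨x, w x⟩ : TangentBundle (𝓡 n) X)) y := fun y hy =>
      hext.contMDiffAt (mem_of_superset (hU'o.mem_nhds hy) hU'U)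
    let a : X → ℝ := fun y => B y (V y) (w y)
    let b : X → ℝ := fun y => B y (J.toFun y (V y)) (w y)
    have ha : ∀ y ∈ U', ContMDiffAt (𝓡 n) 𝓘(ℝ, ℝ) ∞ a y := fun y hy =>
      hΩ.smooth.contMDiffAt_apply (hV y) (hw' y hy)
    have hb : ∀ y ∈ U', ContMDiffAt (𝓡 n) 𝓘(ℝ, ℝ) ∞ b y := fun y hy =>
      hΩ.smooth.contMDiffAt_apply (hJV y) (hw' y hy)
    have hne : ∀ᶠ y in 𝓝 x₀, a y ≠ 0 := by
      refine (ha x₀ hxU').continuousAt.eventually_ne ?_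
      simp only [a, hw, FiberBundle.extend_apply_self]
      exact hw₀
    -- `p w + q J w` with `p + i q = 1 / (a - i b)` has complex area one with `V`, where `a - i b`
    -- is the complex area of `V` and `w`
    have hD : ∀ y, a y ≠ 0 → a y ^ 2 + b y ^ 2 ≠ 0 := fun y hy => by positivity
    refine ⟨U' ∩ {y | a y ≠ 0}, inter_mem (hU'o.mem_nhds hxU') hne,
      fun y => (a y / (a y ^ 2 + b y ^ 2)) • w y + (b y / (a y ^ 2 + b y ^ 2)) • J.toFun y (w y),
      fun y hy => ?_, fun y hy => ?_⟩
    · have hDs := ((ha y hy.1).pow 2).add ((hb y hy.1).pow 2)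
      have hp := (ha y hy.1).div₀ hDs (hD y hy.2)
      have hq := (hb y hy.1).div₀ hDs (hD y hy.2)
      have hJw := (J.smooth y).clm_bundle_apply (hw' y hy.1)
      exact ((hp.smul_section (hw' y hy.1)).add_section (hq.smul_section hJw)).contMDiffWithinAt
    · have h1 : B y (V y) (J.toFun y (w y)) = b y :=
        (apply_complexStructure_left (B := B y) (J := (J.toFun y).toLinearMap) (J.sq_eq_neg y)
          (hJ y) (V y) (w y)).symm
      have h2 : B y (J.toFun y (V y)) (J.toFun y (w y)) = -a y := hJ y (V y) (w y)
      have hDy := hD y hy.2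
      simp only [map_add, map_smul, smul_eq_mul, h1, h2]
      change _ * a y + _ = 1 ∧ _ * b y + _ = 0
      constructor
      · field_simp
      · field_simp
        ring
  obtain ⟨W, hW⟩ := exists_contMDiffSection_forall_mem_convex_of_local (n := ⊤) (𝓡 n)
    (F_fiber := EuclideanSpace ℝ (Fin n)) (fun x : X => TangentSpace (𝓡 n) x)
    (fun x => {w | B x (V x) w = 1 ∧ B x (J.toFun x (V x)) w = 0})
    (fun x => ((convex_singleton (1 : ℝ)).is_linear_preimage (B x (V x)).isLinear).inter
      ((convex_singleton (0 : ℝ)).is_linear_preimage (B x (J.toFun x (V x))).isLinear)) hloc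
  exact ⟨W, W.contMDiff, hW⟩

/-- A field of endomorphisms of the tangent spaces is smooth if it is smooth on the local extensions
of vectors that are constant in the trivializations. -/
theorem contMDiff_hom_of_apply_extend
    {J : (x : X) → TangentSpace (𝓡 n) x →L[ℝ] TangentSpace (𝓡 n) x}
    (hJ : ∀ (x₀ : X) (v : TangentSpace (𝓡 n) x₀), ContMDiffAt (𝓡 n) (𝓡 n).tangent ∞
      (fun x => (⟨x, J x (FiberBundle.extend (EuclideanSpace ℝ (Fin n)) v x)⟩ :
        TangentBundle (𝓡 n) X)) x₀) :
    ContMDiff (𝓡 n)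
      ((𝓡 n).prod 𝓘(ℝ, EuclideanSpace ℝ (Fin n) →L[ℝ] EuclideanSpace ℝ (Fin n))) ∞
      (fun x => Bundle.TotalSpace.mk' (EuclideanSpace ℝ (Fin n) →L[ℝ] EuclideanSpace ℝ (Fin n))
        (E := fun x : X => TangentSpace (𝓡 n) x →L[ℝ] TangentSpace (𝓡 n) x) x (J x)) := by
  intro x₀
  rw [contMDiffAt_hom_bundle]
  refine ⟨contMDiffAt_id, ?_⟩
  refine contMDiffAt_clm_of_apply fun u => ?_
  set e := trivializationAt (EuclideanSpace ℝ (Fin n)) (TangentSpace (𝓡 n)) x₀ with he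
  have hx₀ : x₀ ∈ e.baseSet := FiberBundle.mem_baseSet_trivializationAt' x₀
  refine ((contMDiffAt_section x₀).1 (hJ x₀ (e.symm x₀ u))).congr_of_eventuallyEq ?_
  filter_upwards [e.open_baseSet.mem_nhds hx₀] with x hx
  have h1 : FiberBundle.extend (EuclideanSpace ℝ (Fin n)) (e.symm x₀ u) x = e.symm x u := by
    rw [FiberBundle.extend, ← he, e.apply_mk_symm hx₀]
  rw [h1]
  refine Eq.trans ?_ (congrFun (e.coe_linearMapAt_of_mem (R := ℝ) hx) (J x (e.symm x u)))
  rw [← e.symmL_apply (R := ℝ) hx]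
  rfl

end VectorFields

/-! ### Anti-invariance and symplectic trivialization -/

variable {X : Type*} [TopologicalSpace X] [ChartedSpace (EuclideanSpace ℝ (Fin 4)) X]
  [IsManifold (𝓡 4) ∞ X]

/-- The direction that needs noncompactness: the frame is `V, J V, W, -J W`, where `V` vanishes
nowhere and `W` has complex area one with `V`. -/
theorem isSymplecticallyTrivial_of_isAntiInvariant [T2Space X] [SecondCountableTopology X]
    (hopen : ∀ x : X, ¬ IsCompact (connectedComponent x)) {Ω : Form 4 2 X} (hΩ : IsSymplectic Ω)
    (J : AlmostComplexStructure 4 X) (hJ : J.IsAntiInvariant Ω) : IsSymplecticallyTrivial Ω := by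
  obtain ⟨s, hs, hs0⟩ := exists_isContinuousSection_ne_zero (EuclideanSpace ℝ (Fin 4))
    (fun x : X => TangentSpace (𝓡 4) x) hopen
  obtain ⟨V, hV, hV0⟩ := exists_smooth_vectorField_ne_zero hΩ hs hs0
  obtain ⟨W, hW, hVW⟩ := J.exists_smooth_vectorField_apply_eq hΩ hJ hV hV0
  have hJs : ∀ {Y : (x : X) → TangentSpace (𝓡 4) x}, IsSmoothVectorField Y →
      IsSmoothVectorField fun x => J.toFun x (Y x) := fun h => ContMDiff.clm_bundle_apply J.smooth h
  refine ⟨fun i x => ![V x, J.toFun x (V x)] i, fun i x => ![W x, -J.toFun x (W x)] i, ?_, ?_,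
    fun x => ?_⟩
  · intro i
    fin_cases i
    · exact hV
    · exact hJs hV
  · intro i
    fin_cases i
    · exact hW
    · exact (hJs hW).neg_section
  · exact isSymplecticFrame_of_complexStructure (B := alternatingBilin (Ω x))
      (J := (J.toFun x).toLinearMap) (alternatingBilin_isAlt _) (J.sq_eq_neg x) (hJ x)
      (hVW x).1 (hVW x).2

theorem exists_isAntiInvariant_of_isSymplecticallyTrivial {Ω : Form 4 2 X} (hΩ : IsSymplectic Ω)
    (h : IsSymplecticallyTrivial Ω) : ∃ J : AlmostComplexStructure 4 X, J.IsAntiInvariant Ω := by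
  obtain ⟨V, W, hV, hW, hVW⟩ := h
  let B := fun x => alternatingBilin (Ω x)
  have hB : ∀ x, (B x).IsAlt := fun x => alternatingBilin_isAlt _
  have hdim : ∀ x : X, Module.finrank ℝ (TangentSpace (𝓡 4) x) = 4 := fun x =>
    (finrank_euclideanSpace_fin :
      Module.finrank ℝ (EuclideanSpace ℝ (Fin 4)) = 4)
  have hframe : ∀ x, IsSymplecticFrame (B x) (fun i => V i x) (fun i => W i x) := hVW
  let L : (x : X) → TangentSpace (𝓡 4) x →ₗ[ℝ] TangentSpace (𝓡 4) x := fun x =>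
    frameRotation (B x) (fun i => V i x) (fun i => W i x)
  let J : (x : X) → TangentSpace (𝓡 4) x →L[ℝ] TangentSpace (𝓡 4) x := fun x =>
    have : FiniteDimensional ℝ (TangentSpace (𝓡 4) x) :=
      Module.finite_of_finrank_pos (by rw [hdim x]; norm_num)
    have : T2Space (TangentSpace (𝓡 4) x) := inferInstanceAs (T2Space (EuclideanSpace ℝ (Fin 4)))
    LinearMap.toContinuousLinearMap (L x)
  refine ⟨⟨J, contMDiff_hom_of_apply_extend fun x₀ v => ?_, fun x v =>
    (hframe x).frameRotation_sq (hB x) (hdim x) v⟩, fun x v w =>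
    (hframe x).frameRotation_antiInvariant (hB x) (hdim x) v w⟩
  set y := FiberBundle.extend (EuclideanSpace ℝ (Fin 4)) v
  have hy : ContMDiffAt (𝓡 4) (𝓡 4).tangent ∞ (fun x => (⟨x, y x⟩ : TangentBundle (𝓡 4) X)) x₀ :=
    FiberBundle.contMDiffAt_extend (𝓡 4) (EuclideanSpace ℝ (Fin 4)) v
  have hterm : ∀ {P Q : (x : X) → TangentSpace (𝓡 4) x}, IsSmoothVectorField P →
      IsSmoothVectorField Q → ContMDiffAt (𝓡 4) (𝓡 4).tangent ∞
        (fun x => (⟨x, Ω x ![y x, P x] • Q x⟩ : TangentBundle (𝓡 4) X)) x₀ := fun hP hQ =>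
    (hΩ.smooth.contMDiffAt_apply hy (hP x₀)).smul_section (hQ x₀)
  exact ((hterm (hW 0) (hV 1)).sub_section (hterm (hW 1) (hV 0))).add_section
    ((hterm (hV 0) (hW 1)).sub_section (hterm (hV 1) (hW 0)))

/-- An anti-invariant symplectic form represents its own class, because it differs from itself by
`d 0`. -/
theorem AlmostComplexStructure.IsAntiInvariant.classMem {J : AlmostComplexStructure 4 X}
    {Ω : Form 4 2 X} (hJ : J.IsAntiInvariant Ω) (hΩ : IsSymplectic Ω) :
    J.ClassMemAntiInvariantCohomology Ω := by
  have h0 : ∀ (k : ℕ) (x₀ : X), (0 : Form 4 k X).inChart x₀ = 0 := fun k x₀ => by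
    funext u
    ext v
    rfl
  refine ⟨Ω, hΩ.smooth, hΩ.closed, hJ, 0, fun x₀ => ?_, fun x₀ u _ => ?_⟩
  · rw [h0]
    exact contDiffOn_const
  · rw [sub_self, h0, h0]
    simpa using (extDeriv_smul (x := u) (0 : ℝ) (0 : EuclideanSpace ℝ (Fin 4) →
      EuclideanSpace ℝ (Fin 4) [⋀^Fin 1]→L[ℝ] ℝ)).symm

end AntiInvariant

theorem theorem3p1 {X : Type*} [TopologicalSpace X] [T2Space X] [SecondCountableTopology X]
    [ChartedSpace (EuclideanSpace ℝ (Fin 4)) X] [IsManifold (𝓡 4) ∞ X]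
    (hopen : ∀ x : X, ¬ IsCompact (connectedComponent x))
    (Ω : AntiInvariant.Form 4 2 X) (hΩ : AntiInvariant.IsSymplectic Ω) :
    (∃ J : AntiInvariant.AlmostComplexStructure 4 X,
        J.IsAntiInvariant Ω ∧ J.ClassMemAntiInvariantCohomology Ω) ↔
      AntiInvariant.IsSymplecticallyTrivial Ω := by
  constructor
  · rintro ⟨J, hJ, -⟩
    exact AntiInvariant.isSymplecticallyTrivial_of_isAntiInvariant hopen hΩ J hJ
  · intro h
    obtain ⟨J, hJ⟩ := AntiInvariant.exists_isAntiInvariant_of_isSymplecticallyTrivial hΩ h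
    exact ⟨J, hJ, hJ.classMem hΩ⟩
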